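/- A graph is a pair $\Gamma=(N,B)$ with $N$ a finite set and $B=(B_{ij})_{i,j\in N}$ a symmetric matrix of non-negative integers with zero diagonal. It is called a fission graph if it is the core diagram $\Gamma_c(E,\nabla)$ of some algebraic connection $(E,\nabla)$ on the affine line $\mathbb{A}^1(\mathbb{C})$ whose irregular class $\Theta=\sum_i n_i I_i$ at infinity is untwisted. Here the $I_i$ are the pairwise distinct Stokes circles (Galois orbits $\langle q\rangle$ of Puiseux polynomials $q=\sum_{k>0} a_k z^{k}$, $k\in\mathbb{Q}$) of the exponential factors $e^{q}$ of $(E,\nabla)$ at infinity, with multiplicities $n_i\geq 1$; $\Theta$ is untwisted if every $I_i=\langle q_i\rangle$ has ramification order $1$, i.e. every $q_i$ is a polynomial in $z$. The core diagram has the Stokes circles $I_i$ as its vertices, and its entries are the loop multiplicities $B_{I_i,I_i}$ and the edge multiplicities $B_{I_i,I_j}$ ($i\neq j$) of these circles; in the untwisted case $B_{I_i,I_i}=0$ and $B_{I_i,I_j}=\deg(q_i-q_j)-1$ for $i\neq j$. **Theorem.** Let $\Gamma=(N,B)$ be a graph. Then $\Gamma$ is a fission graph if and only if all its triangles are acute isosceles,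 i.e. for all pairwise distinct $i,j,k\in N$ the two largest of the three numbers $B_{ij}$, $B_{ik}$, $B_{jk}$ are equal. -/

import Mathlib

open Polynomial

noncomputable section

namespace NAH

/-! ### Diagrams and graphs -/

/-- A diagram on a vertex set `N`: a symmetric integer matrix with even diagonal entries.
For `i ≠ j` the entry `mult i j` is the number of edges between `i` and `j`, and `mult i i / 2`
is the number of loops at `i`; both may be negative. -/
structure Diagram (N : Type*) where
  mult : Matrix N N ℤ
  symm : mult.IsSymm
  even_diag : ∀ i, Even (mult i i)

/-- A graph: a diagram without loops and without negative edges. -/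
def Diagram.IsGraph {N : Type*} (Γ : Diagram N) : Prop :=
  (∀ i j, 0 ≤ Γ.mult i j) ∧ ∀ i, Γ.mult i i = 0

/-- Among the three edge multiplicities of `i, j, k`, the two largest are equal. -/
def Diagram.IsAcuteIsosceles {N : Type*} (Γ : Diagram N) (i j k : N) : Prop :=
  (Γ.mult i j ≤ Γ.mult i k ∧ Γ.mult i k = Γ.mult j k) ∨
  (Γ.mult i k ≤ Γ.mult j k ∧ Γ.mult j k = Γ.mult i j) ∨
  (Γ.mult j k ≤ Γ.mult i j ∧ Γ.mult i j = Γ.mult i k)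

/-! ### Exponential factors and Stokes circles at infinity -/

/-- An exponential factor at infinity: a Puiseux polynomial `∑ a_k z ^ k` with finitely many
exponents `k ∈ ℚ`, all of them positive. -/
@[ext]
structure ExpFactor where
  coeff : ℚ →₀ ℂ
  pos : ∀ k ∈ coeff.support, 0 < k

namespace ExpFactor

/-- The exponents of `q`: those `k` for which `z ^ k` occurs in `q`. -/
def exponents (q : ExpFactor) : Finset ℚ := q.coeff.support

/-- All exponents of `q` lie in `(1/r) ℤ`, i.e. `q` is a polynomial in `z ^ (1/r)`. -/
def HasDenominator (q : ExpFactor) (r : ℕ) : Prop :=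
  ∀ k ∈ q.exponents, ∃ m : ℕ, k = m / r

/-- The ramification order: the least `r ≥ 1` such that `q` is a polynomial in `z ^ (1/r)`. -/
def ram (q : ExpFactor) : ℕ := sInf {r : ℕ | 1 ≤ r ∧ q.HasDenominator r}

/-- The slope: the largest exponent of `q`, and `0` for `q = 0`. -/
def slope (q : ExpFactor) : ℚ := (insert 0 q.exponents).max' (Finset.insert_nonempty 0 _)

/-- `p` is a Galois conjugate of `q`: it is obtained by continuing `q` around infinity `m` times,
so that each `z ^ k` is multiplied by `exp (2 π i m k)`. -/
def IsConj (q p : ExpFactor) : Prop :=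
  ∃ m : ℤ, ∀ k : ℚ,
    p.coeff k = Complex.exp (2 * Real.pi * Complex.I * m * k) * q.coeff k

/-- The truncation `τ_k(q)`: the monomials of `q` with exponent `≥ k`. -/
def trunc (k : ℚ) (q : ExpFactor) : ExpFactor where
  coeff := q.coeff.filter (fun l => k ≤ l)
  pos l hl := q.pos l (by
    rw [Finsupp.support_filter] at hl
    exact Finset.filter_subset _ _ hl)

/-- The difference `q - τ_k(q)`: the monomials of `q` with exponent `< k`. -/
def tail (k : ℚ) (q : ExpFactor) : ExpFactor where
  coeff := q.coeff.filter (fun l => l < k)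
  pos l hl := q.pos l (by
    rw [Finsupp.support_filter] at hl
    exact Finset.filter_subset _ _ hl)

theorem IsConj.refl (q : ExpFactor) : IsConj q q := ⟨0, fun k => by simp⟩

theorem IsConj.symm {q p : ExpFactor} (h : IsConj q p) : IsConj p q := by
  obtain ⟨m, hm⟩ := h
  refine ⟨-m, fun k => ?_⟩
  rw [hm k, ← mul_assoc, ← Complex.exp_add]
  push_cast
  rw [show 2 * (Real.pi : ℂ) * Complex.I * -m * k + 2 * Real.pi * Complex.I * m * k = 0 by ring]
  simp

theorem IsConj.trans {q p s : ExpFactor} (h : IsConj q p) (h' : IsConj p s) : IsConj q s := by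
  obtain ⟨m, hm⟩ := h
  obtain ⟨n, hn⟩ := h'
  refine ⟨n + m, fun k => ?_⟩
  rw [hn k, hm k, ← mul_assoc, ← Complex.exp_add]
  push_cast
  congr 2
  ring

theorem IsConj.exponents_eq {q p : ExpFactor} (h : IsConj q p) : q.exponents = p.exponents := by
  obtain ⟨m, hm⟩ := h
  ext k
  simp [exponents, hm k, Complex.exp_ne_zero]

theorem IsConj.trunc {q p : ExpFactor} (h : IsConj q p) (k : ℚ) :
    IsConj (q.trunc k) (p.trunc k) := by
  obtain ⟨m, hm⟩ := h
  refine ⟨m, fun l => ?_⟩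
  by_cases hl : k ≤ l <;> simp [ExpFactor.trunc, hl, hm l]

theorem IsConj.tail {q p : ExpFactor} (h : IsConj q p) (k : ℚ) :
    IsConj (q.tail k) (p.tail k) := by
  obtain ⟨m, hm⟩ := h
  refine ⟨m, fun l => ?_⟩
  by_cases hl : l < k <;> simp [ExpFactor.tail, hl, hm l]

theorem IsConj.ram_eq {q p : ExpFactor} (h : IsConj q p) : q.ram = p.ram := by
  simp [ram, HasDenominator, h.exponents_eq]

theorem IsConj.slope_eq {q p : ExpFactor} (h : IsConj q p) : q.slope = p.slope := by
  simp [slope, h.exponents_eq]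

/-- Galois conjugacy of exponential factors. -/
instance conjSetoid : Setoid ExpFactor where
  r := IsConj
  iseqv := ⟨IsConj.refl, IsConj.symm, IsConj.trans⟩

end ExpFactor

/-- A Stokes circle at infinity: a Galois orbit of exponential factors. -/
def StokesCircle : Type := Quotient ExpFactor.conjSetoid

/-- The Galois orbit `⟨q⟩`. -/
def ExpFactor.circle (q : ExpFactor) : StokesCircle := Quotient.mk _ q

/-- The ramification order of a Stokes circle. -/
def StokesCircle.ram (I : StokesCircle) : ℕ :=
  Quotient.lift ExpFactor.ram (fun _ _ h => ExpFactor.IsConj.ram_eq h) I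

/-- An irregular class at infinity `∑ n_i I_i`: a finite multiset of Stokes circles. -/
abbrev IrregularClass : Type := StokesCircle →₀ ℕ

/-- An irregular class is untwisted if each of its Stokes circles has ramification order `1`. -/
def IrregularClass.IsUntwisted (Θ : IrregularClass) : Prop := ∀ I ∈ Θ.support, I.ram = 1

/-! ### Loop and edge multiplicities of Stokes circles -/

/-- For `k ∈ (1/r) ℕ`, the natural number `m` with `k = m / r`. -/
def numer (r : ℕ) (k : ℚ) : ℕ := (r * k).num.natAbs

/-- `gcd (r, m_0, …, m_t)`, where `m_0 / r, …, m_t / r` are the elements of `E`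
(it is `r` if `E` is empty). -/
def gcdNumer (r : ℕ) (E : Finset ℚ) : ℕ := Nat.gcd r (E.gcd (numer r))

/-- For `E = {k_0 > … > k_t}` with `k_j = m_j / r = m'_j / r'`, this is
`∑ j, m_j * (gcd (r', m'_0, …, m'_{j-1}) - gcd (r', m'_0, …, m'_j))`,
where the first gcd is `r'` for `j = 0`. -/
def levelSum (r r' : ℕ) (E : Finset ℚ) : ℤ :=
  ∑ k ∈ E, (numer r k : ℤ) *
    ((gcdNumer r' (E.filter (fun l => k < l)) : ℤ) - gcdNumer r' (E.filter (fun l => k ≤ l)))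

namespace ExpFactor

/-- The loop multiplicity of `⟨q⟩` (it is `0` for `q = 0`). -/
def loopMult (q : ExpFactor) : ℤ := levelSum q.ram q.ram q.exponents - (q.ram : ℤ) ^ 2 + 1

/-- The least `l ∈ (1 / lcm (r, r')) ℤ_{>0}` such that the truncations `τ_l(q)` and `τ_l(q')` are
Galois conjugate; the common parts of `q` and `q'` are their truncations at this `l`. -/
def cutoff (q q' : ExpFactor) : ℚ :=
  (sInf {m : ℕ | 0 < m ∧ IsConj (q.trunc (m / (Nat.lcm q.ram q'.ram : ℕ)))
    (q'.trunc (m / (Nat.lcm q.ram q'.ram : ℕ)))} : ℕ) / (Nat.lcm q.ram q'.ram : ℕ)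

/-- The common part of `q` with `q'`. -/
def commonPart (q q' : ExpFactor) : ExpFactor := q.trunc (cutoff q q')

/-- The different part of `q` from `q'`: `q` minus its common part. -/
def diffPart (q q' : ExpFactor) : ExpFactor := q.tail (cutoff q q')

/-- The fission exponent of two exponential factors. -/
def fissionExponent (q q' : ExpFactor) : ℚ := max (diffPart q q').slope (diffPart q' q).slope

/-- The formula for the edge multiplicity in the case where the slope of the different part of `q`
is at least that of the different part of `q'`. -/
def edgeFormula (q q' : ExpFactor) : ℤ :=
  levelSum q.ram q'.ram (commonPart q q').exponents
    + (numer q.ram (fissionExponent q q') : ℤ) * gcdNumer q'.ram (commonPart q q').exponents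
    - (q.ram : ℤ) * q'.ram

/-- The edge multiplicity of two distinct Stokes circles `⟨q⟩` and `⟨q'⟩`. -/
def edgeMult (q q' : ExpFactor) : ℤ :=
  if (diffPart q' q).slope ≤ (diffPart q q').slope then edgeFormula q q' else edgeFormula q' q

theorem IsConj.loopMult_eq {q p : ExpFactor} (h : IsConj q p) : q.loopMult = p.loopMult := by
  simp [loopMult, h.exponents_eq, h.ram_eq]

theorem IsConj.cutoff_eq {q p q' p' : ExpFactor} (h : IsConj q p) (h' : IsConj q' p') :
    cutoff q q' = cutoff p p' := by
  have key : ∀ l : ℚ, IsConj (q.trunc l) (q'.trunc l) ↔ IsConj (p.trunc l) (p'.trunc l) :=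
    fun l => ⟨fun H => ((h.trunc l).symm.trans H).trans (h'.trunc l),
      fun H => ((h.trunc l).trans H).trans (h'.trunc l).symm⟩
  simp only [cutoff, h.ram_eq, h'.ram_eq, key]

theorem IsConj.slope_diffPart_eq {q p q' p' : ExpFactor} (h : IsConj q p) (h' : IsConj q' p') :
    (diffPart q q').slope = (diffPart p p').slope := by
  rw [diffPart, diffPart, h.cutoff_eq h']
  exact (h.tail _).slope_eq

theorem IsConj.edgeFormula_eq {q p q' p' : ExpFactor} (h : IsConj q p) (h' : IsConj q' p') :
    edgeFormula q q' = edgeFormula p p' := by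
  have hc : (commonPart q q').exponents = (commonPart p p').exponents := by
    rw [commonPart, commonPart, h.cutoff_eq h']
    exact (h.trunc _).exponents_eq
  simp only [edgeFormula, fissionExponent, hc, h.ram_eq, h'.ram_eq, h.slope_diffPart_eq h',
    h'.slope_diffPart_eq h]

theorem IsConj.edgeMult_eq {q p q' p' : ExpFactor} (h : IsConj q p) (h' : IsConj q' p') :
    edgeMult q q' = edgeMult p p' := by
  simp only [edgeMult, h.edgeFormula_eq h', h'.edgeFormula_eq h, h.slope_diffPart_eq h',
    h'.slope_diffPart_eq h]

end ExpFactor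

open Classical in
/-- The multiplicity `B_{I,J}` attached to a pair of Stokes circles: the loop multiplicity if
`I = J`, the edge multiplicity if `I ≠ J`. -/
def StokesCircle.mult (I J : StokesCircle) : ℤ :=
  if I = J then
    Quotient.lift ExpFactor.loopMult (fun _ _ h => ExpFactor.IsConj.loopMult_eq h) I
  else
    Quotient.lift₂ ExpFactor.edgeMult (fun _ _ _ _ h h' => ExpFactor.IsConj.edgeMult_eq h h') I J

/-- `Γ` is the core diagram `Γ_c(Θ)`: its vertices are identified with the distinct Stokes circles
of `Θ`, in such a way that the entries of `Γ` are the multiplicities of these circles. -/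
def Diagram.IsCoreDiagram {N : Type*} (Γ : Diagram N) (Θ : IrregularClass) : Prop :=
  ∃ e : N ≃ {I : StokesCircle // I ∈ Θ.support},
    ∀ i j, Γ.mult i j = StokesCircle.mult (e i).1 (e j).1

/-! ### Algebraic connections on the affine line and their irregular class at infinity -/

/-- An algebraic connection on the affine line with coordinate `z`: a vector bundle, i.e. a finitely
generated projective `ℂ[z]`-module `E`, with an additive map `∇ = ∇_{d/dz}` satisfying the
Leibniz rule. -/
structure AffineLineConnection where
  E : Type
  [addCommGroup : AddCommGroup E]
  [module : Module ℂ[X] E]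
  [finite : Module.Finite ℂ[X] E]
  [projective : Module.Projective ℂ[X] E]
  nabla : E →+ E
  leibniz : ∀ (f : ℂ[X]) (v : E), nabla (f • v) = derivative f • v + f • nabla v

attribute [instance] AffineLineConnection.addCommGroup AffineLineConnection.module
  AffineLineConnection.finite AffineLineConnection.projective

/-- The embedding `ℂ[z] → ℂ((t))`, where `z = t ^ (-r)`. -/
def atInfinity (r : ℕ) (f : ℂ[X]) : LaurentSeries ℂ :=
  aeval (HahnSeries.single (-(r : ℤ)) (1 : ℂ) : LaurentSeries ℂ) f

/-- The derivation `z d/dz = -(1/r) t d/dt` of `ℂ((t))`, where `z = t ^ (-r)`. -/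
def eulerDeriv (r : ℕ) (f : LaurentSeries ℂ) : LaurentSeries ℂ :=
  (-(r : ℂ)⁻¹) • ((HahnSeries.single (1 : ℤ) (1 : ℂ) : LaurentSeries ℂ)
    * LaurentSeries.derivative ℂ f)

/-- The exponential factor `∑ a_k z ^ k`, with exponents in `(1/r) ℤ`, as the element
`∑ a_k t ^ (-r k)` of `ℂ((t))`, where `z = t ^ (-r)`. -/
def ExpFactor.toLaurent (r : ℕ) (q : ExpFactor) : LaurentSeries ℂ :=
  q.coeff.sum (fun k a => HahnSeries.single (-(numer r k : ℤ)) a)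

/-- The matrix `A` of a connection in a basis `b`, so that `∇ = d/dz + A`. -/
def AffineLineConnection.connMatrix (V : AffineLineConnection) {n : ℕ}
    (b : Module.Basis (Fin n) ℂ[X] V.E) : Matrix (Fin n) (Fin n) ℂ[X] :=
  Matrix.of fun i j => b.repr (V.nabla (b j)) i

/-- `Θ` is the irregular class of `(E, ∇)` at infinity. This says that, after pullback to `ℂ((t))`
with `z = t ^ (-r)` for some `r ≥ 1`, the connection is isomorphic to a direct sum of
connections `(ℂ((t)), d - dq) ⊗ R_q` with `q` running through exponential factors and `R_q`
regular singular, and that each `q` has multiplicity `rank R_q = Θ ⟨q⟩`.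

Concretely there are a basis of `E` (in which `∇ = d/dz + A`) and exponential factors
`q 1, …, q n`, and the invertible matrix `G` is a change of basis over `ℂ((t))` after which
`z ∇` has the matrix `R - diag (z dq_i/dz)`, where `R` has entries in `ℂ[[t]]` and is
block-diagonal with respect to the distinct values of `q`. -/
def AffineLineConnection.HasIrregularClass (V : AffineLineConnection) (Θ : IrregularClass) :
    Prop :=
  ∃ (r n : ℕ) (b : Module.Basis (Fin n) ℂ[X] V.E) (q : Fin n → ExpFactor)
    (G : GL (Fin n) (LaurentSeries ℂ)) (R : Matrix (Fin n) (Fin n) (PowerSeries ℂ)),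
    1 ≤ r ∧
    (∀ i, (q i).HasDenominator r) ∧
    (∀ i j, q i ≠ q j → R i j = 0) ∧
    atInfinity r X • ((V.connMatrix b).map (atInfinity r) * G.1) + G.1.map (eulerDeriv r) =
      G.1 * (R.map (HahnSeries.ofPowerSeries ℤ ℂ) -
        Matrix.diagonal fun i => eulerDeriv r ((q i).toLaurent r)) ∧
    ∀ p : ExpFactor, Nat.card {i : Fin n // q i = p} = Θ p.circle

/-- A fission graph: the core diagram of an algebraic connection on the affine line whose irregular
class at infinity is untwisted. -/
def Diagram.IsFissionGraph {N : Type*} (Γ : Diagram N) : Prop :=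
  ∃ (V : AffineLineConnection) (Θ : IrregularClass),
    V.HasIrregularClass Θ ∧ Θ.IsUntwisted ∧ Γ.IsCoreDiagram Θ

end NAH

end

/-!
An untwisted exponential factor is a polynomial up to an additive constant, and its monodromy is
trivial, so an untwisted irregular class is a family of polynomials `P i`, and the multiplicities
of its core diagram are `deg (P i - P j) - 1`. Degrees of differences satisfy the ultrametric
inequality, which for the numbers `B i j + 1` says that all triangles are acute isosceles.

Conversely, every `ℕ`-valued ultrametric `d` on a finite set has the form `deg (P i - P j)`: let the
coefficient of `X ^ (k + 1)` in `P i` be a label of the ball of radius `k` around `i`, so that `P i`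
and `P j` agree precisely in the degrees above `d i j`. Any finite family of polynomials is realized
by the connection `⨁ (ℂ[z], d - dP i)`.
-/

noncomputable section

namespace NAH

/-! ### Ultrametrics and degrees of differences of polynomials -/

section Ultrametric

variable {N R : Type*} [Ring R]

/-- An ultrametric with natural number values, used for `deg (P i - P j)`. Distinct points are
allowed to have distance `0`, as polynomials may differ by a constant. -/
structure IsUltrametric (d : N → N → ℕ) : Prop where
  self : ∀ i, d i i = 0
  symm : ∀ i j, d i j = d j i
  le_max : ∀ i j k, d i k ≤ max (d i j) (d j k)

theorem isUltrametric_natDegree_sub (P : N → R[X]) :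
    IsUltrametric fun i j => (P i - P j).natDegree where
  self i := by simp
  symm i j := natDegree_sub
  le_max i j k := by
    rw [← sub_add_sub_cancel (P i) (P j) (P k)]
    exact natDegree_add_le _ _

theorem IsUltrametric.closedBall_eq_iff {d : N → N → ℕ} (hd : IsUltrametric d) {i j : N} {k : ℕ} :
    {x | d i x ≤ k} = {x | d j x ≤ k} ↔ d i j ≤ k := by
  constructor
  · intro h
    have hj : j ∈ {x | d j x ≤ k} := (hd.self j).trans_le k.zero_le
    rwa [← h] at hj
  · intro hij
    ext x
    exact ⟨fun hx => (hd.le_max j i x).trans (max_le (hd.symm j i ▸ hij) hx),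
      fun hx => (hd.le_max i j x).trans (max_le hij hx)⟩

theorem IsUltrametric.exists_natDegree_sub_eq [Finite N] [Infinite R] {d : N → N → ℕ}
    (hd : IsUltrametric d) : ∃ P : N → R[X], ∀ i j, (P i - P j).natDegree = d i j := by
  obtain ⟨f, hf⟩ : ∃ f : Set N → R, Function.Injective f :=
    (exists_injective_nat (Set N)).imp' (Infinite.natEmbedding R ∘ ·)
      fun _ h => (Infinite.natEmbedding R).injective.comp h
  obtain ⟨M, hM⟩ := (Set.finite_range fun x : N × N => d x.1 x.2).bddAbove
  let P (i : N) : R[X] := ∑ k ∈ Finset.range M, monomial (k + 1) (f {x | d i x ≤ k})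
  have hP (i : N) (k : ℕ) :
      (P i).coeff (k + 1) = if k < M then f {x | d i x ≤ k} else 0 := by
    simp [P, coeff_monomial]
  refine ⟨P, fun i j => le_antisymm ?_ ?_⟩
  · refine natDegree_le_iff_coeff_eq_zero.2 fun k hk => ?_
    obtain ⟨k, rfl⟩ := Nat.exists_eq_add_one_of_ne_zero (Nat.ne_zero_of_lt hk)
    rw [coeff_sub, hP, hP, hd.closedBall_eq_iff.2 (Nat.lt_succ_iff.1 hk), sub_self]
  · rcases h : d i j with _ | k
    · exact Nat.zero_le _
    · have hkM : k < M := Nat.lt_of_succ_le (h.symm.trans_le (hM ⟨(i, j), rfl⟩))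
      refine le_natDegree_of_ne_zero ?_
      rw [coeff_sub, hP, hP, if_pos hkM, if_pos hkM, sub_ne_zero, hf.ne_iff, Ne,
        hd.closedBall_eq_iff, h]
      exact Nat.not_succ_le_self k

end Ultrametric

/-! ### Untwisted exponential factors -/

theorem erase_zero_eq_self {R : Type*} [Semiring R] {P : R[X]} (h : P.coeff 0 = 0) :
    P.erase 0 = P := by
  simpa [h] using monomial_add_erase P 0

namespace ExpFactor

/-- The untwisted exponential factor given by a polynomial in `z`. The constant term is dropped:
exponential factors are taken modulo constants. -/
def ofPolynomial (P : ℂ[X]) : ExpFactor where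
  coeff := (P.erase 0).toFinsupp.coeff.embDomain Nat.castEmbedding
  pos k hk := by
    rw [Finsupp.support_embDomain] at hk
    obtain ⟨m, hm, rfl⟩ := Finset.mem_map.1 hk
    rw [Nat.castEmbedding_apply, Nat.cast_pos, Nat.pos_iff_ne_zero]
    rintro rfl
    exact Finsupp.mem_support_iff.1 hm (coeff_erase P 0 0)

theorem coeff_ofPolynomial_natCast (P : ℂ[X]) (k : ℕ) :
    (ofPolynomial P).coeff k = (P.erase 0).coeff k :=
  Finsupp.embDomain_apply_self Nat.castEmbedding _ k

theorem coeff_ofPolynomial_of_notMem_range (P : ℂ[X]) {k : ℚ} (hk : k ∉ Set.range Nat.cast) :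
    (ofPolynomial P).coeff k = 0 :=
  Finsupp.embDomain_of_notMem_range _ _ _ hk

theorem hasDenominator_one_iff {q : ExpFactor} :
    q.HasDenominator 1 ↔ ∃ P : ℂ[X], ofPolynomial P = q := by
  constructor
  · intro hq
    have hsupp : ↑q.coeff.support ⊆ Set.range (Nat.castEmbedding (R := ℚ)) := fun k hk => by
      obtain ⟨m, rfl⟩ := hq k hk
      exact ⟨m, by simp⟩
    let P : ℂ[X] := ⟨.ofCoeff (q.coeff.comapDomain _ Nat.castEmbedding.injective.injOn)⟩
    have hP : P.coeff 0 = 0 := by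
      by_contra h
      simpa using q.pos ((0 : ℕ) : ℚ) (Finsupp.mem_support_iff.2 h)
    refine ⟨P, ExpFactor.ext_iff.2 ?_⟩
    simp only [ofPolynomial, erase_zero_eq_self hP]
    exact Finsupp.embDomain_comapDomain hsupp
  · rintro ⟨P, rfl⟩ k hk
    by_contra! h
    exact Finsupp.mem_support_iff.1 hk (coeff_ofPolynomial_of_notMem_range P
      fun ⟨m, hm⟩ => h m (by simp [← hm]))

theorem ram_eq_one_iff {q : ExpFactor} : q.ram = 1 ↔ q.HasDenominator 1 := by
  constructor
  · intro h
    have hne : {r : ℕ | 1 ≤ r ∧ q.HasDenominator r}.Nonempty :=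
      Nat.nonempty_of_sInf_eq_succ h
    have hmem := Nat.sInf_mem hne
    rw [← ram, h] at hmem
    exact hmem.2
  · intro h
    have hmem : 1 ∈ {r : ℕ | 1 ≤ r ∧ q.HasDenominator r} := ⟨le_rfl, h⟩
    exact le_antisymm (Nat.sInf_le hmem) (Nat.sInf_mem ⟨1, hmem⟩).1

theorem hasDenominator_one_ofPolynomial (P : ℂ[X]) : (ofPolynomial P).HasDenominator 1 :=
  hasDenominator_one_iff.2 ⟨P, rfl⟩

theorem ram_ofPolynomial (P : ℂ[X]) : (ofPolynomial P).ram = 1 :=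
  ram_eq_one_iff.2 (hasDenominator_one_ofPolynomial P)

theorem HasDenominator.isConj_iff {q p : ExpFactor} (h : q.HasDenominator 1) :
    IsConj q p ↔ q = p := by
  refine ⟨fun ⟨m, hm⟩ => ?_, fun H => H ▸ IsConj.refl q⟩
  ext k
  rw [hm k]
  by_cases hk : q.coeff k = 0
  · simp [hk]
  · obtain ⟨l, rfl⟩ := h k (Finsupp.mem_support_iff.2 hk)
    have hexp : Complex.exp (2 * Real.pi * Complex.I * m * ((l / (1 : ℕ) : ℚ) : ℂ)) = 1 :=
      Complex.exp_eq_one_iff.2 ⟨m * l, by push_cast; ring⟩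
    rw [hexp, one_mul]

theorem HasDenominator.circle_eq_iff {q p : ExpFactor} (h : q.HasDenominator 1) :
    q.circle = p.circle ↔ q = p :=
  Quotient.eq.trans h.isConj_iff

theorem HasDenominator.trunc {q : ExpFactor} {r : ℕ} (h : q.HasDenominator r) (l : ℚ) :
    (q.trunc l).HasDenominator r := fun k hk => h k <| by
  simp only [exponents, ExpFactor.trunc, Finsupp.support_filter, Finset.mem_filter] at hk
  exact hk.1

/-! ### Multiplicities of untwisted circles -/

variable (P Q : ℂ[X])

theorem trunc_ofPolynomial_eq_iff {m : ℕ} (hm : 0 < m) :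
    (ofPolynomial P).trunc m = (ofPolynomial Q).trunc m ↔ (P - Q).natDegree < m := by
  have hcoeff : (P - Q).natDegree < m ↔ ∀ k, m ≤ k → P.coeff k = Q.coeff k := by
    obtain ⟨n, rfl⟩ := Nat.exists_eq_add_one_of_ne_zero hm.ne'
    simp only [Nat.lt_succ_iff, natDegree_le_iff_coeff_eq_zero, coeff_sub, sub_eq_zero,
      Nat.succ_le_iff]
  rw [hcoeff, ExpFactor.ext_iff, Finsupp.ext_iff]
  constructor
  · intro h k hk
    have hk0 : k ≠ 0 := (hm.trans_le hk).ne'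
    simpa [ExpFactor.trunc, coeff_ofPolynomial_natCast, coeff_erase, hk, hk0] using h k
  · intro h x
    by_cases hx : x ∈ Set.range ((↑) : ℕ → ℚ)
    · obtain ⟨k, rfl⟩ := hx
      by_cases hk : m ≤ k
      · simp [ExpFactor.trunc, coeff_ofPolynomial_natCast, coeff_erase, hk, h k hk]
      · simp [ExpFactor.trunc, hk]
    · simp [ExpFactor.trunc, Finsupp.filter_apply, coeff_ofPolynomial_of_notMem_range _ hx]

theorem cutoff_ofPolynomial :
    cutoff (ofPolynomial P) (ofPolynomial Q) = ((P - Q).natDegree + 1 : ℕ) := by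
  have hset : {m : ℕ | 0 < m ∧ IsConj ((ofPolynomial P).trunc m) ((ofPolynomial Q).trunc m)} =
      Set.Ici ((P - Q).natDegree + 1) := by
    ext m
    simp only [Set.mem_ofPred_eq, Set.mem_Ici, Nat.succ_le_iff,
      ((hasDenominator_one_ofPolynomial P).trunc m).isConj_iff]
    exact ⟨fun ⟨hm, h⟩ => (trunc_ofPolynomial_eq_iff P Q hm).1 h, fun h =>
      have hm := Nat.zero_lt_of_lt h
      ⟨hm, (trunc_ofPolynomial_eq_iff P Q hm).2 h⟩⟩
  simp [cutoff, ram_ofPolynomial, hset]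

theorem slope_tail_ofPolynomial_le (d : ℕ) :
    ((ofPolynomial P).tail (d + 1 : ℕ)).slope ≤ d := by
  refine Finset.max'_le _ _ _ fun k hk => ?_
  rcases Finset.mem_insert.1 hk with rfl | hk
  · exact Nat.cast_nonneg d
  · simp only [exponents, ExpFactor.tail, Finsupp.support_filter, Finset.mem_filter] at hk
    obtain ⟨hk, hkd⟩ := hk
    obtain ⟨m, rfl⟩ := hasDenominator_one_ofPolynomial P k hk
    simp only [Nat.cast_one, div_one, Nat.cast_lt, Nat.cast_le] at hkd ⊢
    exact Nat.lt_succ_iff.1 hkd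

theorem le_slope_tail_ofPolynomial {d : ℕ} (hd : d ≠ 0) (hP : P.coeff d ≠ 0) :
    d ≤ ((ofPolynomial P).tail (d + 1 : ℕ)).slope := by
  refine Finset.le_max' _ _ (Finset.mem_insert_of_mem ?_)
  simp [exponents, ExpFactor.tail, coeff_ofPolynomial_natCast, hd, hP]

theorem slope_nonneg (q : ExpFactor) : 0 ≤ q.slope :=
  Finset.le_max' _ _ (Finset.mem_insert_self _ _)

theorem fissionExponent_ofPolynomial :
    fissionExponent (ofPolynomial P) (ofPolynomial Q) = (P - Q).natDegree := by
  rw [fissionExponent, diffPart, diffPart, cutoff_ofPolynomial, cutoff_ofPolynomial,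
    natDegree_sub (p := Q)]
  refine le_antisymm (max_le (slope_tail_ofPolynomial_le P _) (slope_tail_ofPolynomial_le Q _)) ?_
  by_cases hd : (P - Q).natDegree = 0
  · exact le_max_of_le_left (by simpa [hd] using slope_nonneg _)
  · have hlead : P.coeff (P - Q).natDegree ≠ Q.coeff (P - Q).natDegree := by
      rw [← sub_ne_zero, ← coeff_sub, coeff_natDegree, leadingCoeff_ne_zero]
      intro h
      simp [h] at hd
    by_cases hP : P.coeff (P - Q).natDegree = 0
    · have hQ : Q.coeff (P - Q).natDegree ≠ 0 := fun hQ => hlead (hP.trans hQ.symm)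
      exact le_max_of_le_right (le_slope_tail_ofPolynomial Q hd hQ)
    · exact le_max_of_le_left (le_slope_tail_ofPolynomial P hd hP)

theorem levelSum_one (r : ℕ) (E : Finset ℚ) : levelSum r 1 E = 0 := by
  simp [levelSum, gcdNumer]

theorem loopMult_ofPolynomial : (ofPolynomial P).loopMult = 0 := by
  simp [loopMult, ram_ofPolynomial, levelSum_one]

theorem edgeFormula_ofPolynomial :
    edgeFormula (ofPolynomial P) (ofPolynomial Q) = (P - Q).natDegree - 1 := by
  simp [edgeFormula, ram_ofPolynomial, levelSum_one, fissionExponent_ofPolynomial, gcdNumer, numer]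

theorem edgeMult_ofPolynomial :
    edgeMult (ofPolynomial P) (ofPolynomial Q) = (P - Q).natDegree - 1 := by
  rw [edgeMult, edgeFormula_ofPolynomial, edgeFormula_ofPolynomial, natDegree_sub (p := Q),
    ite_self]

theorem trunc_one_ofPolynomial : (ofPolynomial P).trunc (1 : ℕ) = ofPolynomial P := by
  rw [ExpFactor.ext_iff]
  refine (Finsupp.filter_eq_self_iff _ _).2 fun k hk => ?_
  have hk := Finsupp.mem_support_iff.2 hk
  have hpos := (ofPolynomial P).pos k hk
  obtain ⟨m, rfl⟩ := hasDenominator_one_ofPolynomial P k hk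
  simp only [Nat.cast_one, div_one, Nat.cast_pos] at hpos
  simpa using Nat.succ_le_of_lt hpos

theorem ofPolynomial_eq_iff : ofPolynomial P = ofPolynomial Q ↔ (P - Q).natDegree = 0 := by
  rw [← trunc_one_ofPolynomial P, ← trunc_one_ofPolynomial Q,
    trunc_ofPolynomial_eq_iff P Q one_pos, Nat.lt_one_iff]

theorem mult_circle_ofPolynomial :
    StokesCircle.mult (ofPolynomial P).circle (ofPolynomial Q).circle =
      ((P - Q).natDegree - 1 : ℕ) := by
  by_cases h : (P - Q).natDegree = 0
  · rw [(ofPolynomial_eq_iff P Q).2 h, StokesCircle.mult, if_pos rfl, h]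
    exact loopMult_ofPolynomial Q
  · have hne : (ofPolynomial P).circle ≠ (ofPolynomial Q).circle := fun hc =>
      h ((ofPolynomial_eq_iff P Q).1 ((hasDenominator_one_ofPolynomial P).circle_eq_iff.1 hc))
    rw [StokesCircle.mult, if_neg hne, Nat.cast_pred (Nat.pos_of_ne_zero h)]
    exact edgeMult_ofPolynomial P Q

end ExpFactor

open ExpFactor

/-! ### Direct sums of connections of rank one -/

/-- The connection `d - diag (p_1, …, p_n) dz` on the trivial bundle. It is the direct sum of the
rank one connections `d - p_i dz`, which have the solutions `exp (∫ p_i dz)`. -/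
def AffineLineConnection.diagonal {n : ℕ} (p : Fin n → ℂ[X]) : AffineLineConnection where
  E := Fin n → ℂ[X]
  nabla :=
    { toFun := fun v i => derivative (v i) - p i * v i
      map_zero' := by ext; simp
      map_add' := fun v w => by
        ext1 i
        simp only [Pi.add_apply, derivative_add]
        ring }
  leibniz f v := by
    ext1 i
    simp only [AddMonoidHom.coe_mk, ZeroHom.coe_mk, Pi.add_apply, Pi.smul_apply, smul_eq_mul,
      derivative_mul]
    ring

theorem AffineLineConnection.connMatrix_diagonal {n : ℕ} (p : Fin n → ℂ[X]) :
    (diagonal p).connMatrix (Pi.basisFun ℂ[X] (Fin n)) = Matrix.diagonal (-p) := by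
  ext1 i j
  change derivative (Pi.basisFun ℂ[X] (Fin n) j i) - p i * Pi.basisFun ℂ[X] (Fin n) j i = _
  rcases eq_or_ne i j with rfl | h
  · simp
  · simp [h]

theorem atInfinity_eq_aeval (r : ℕ) :
    atInfinity r = aeval (HahnSeries.single (-(r : ℤ)) (1 : ℂ) : LaurentSeries ℂ) :=
  rfl

theorem atInfinity_monomial (r k : ℕ) (a : ℂ) :
    atInfinity r (monomial k a) = HahnSeries.single (-(r * k : ℤ)) a := by
  rw [atInfinity, aeval_monomial, HahnSeries.single_pow, HahnSeries.algebraMap_apply',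
    PowerSeries.algebraMap_apply, HahnSeries.ofPowerSeries_C, HahnSeries.C_apply,
    HahnSeries.single_mul_single]
  simp [mul_comm]

theorem numer_natCast (r k : ℕ) : numer r k = r * k := by
  rw [numer, ← Nat.cast_mul, Rat.num_natCast, Int.natAbs_natCast]

theorem toLaurent_ofPolynomial (r : ℕ) (P : ℂ[X]) :
    (ofPolynomial P).toLaurent r = atInfinity r (P.erase 0) := by
  have hmap : atInfinity r (P.erase 0) =
      ∑ k ∈ (P.erase 0).support, atInfinity r (monomial k ((P.erase 0).coeff k)) := by
    rw [atInfinity_eq_aeval, ← map_sum, ← as_sum_support]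
  rw [hmap, ExpFactor.toLaurent, ofPolynomial, Finsupp.sum_embDomain]
  refine Finset.sum_congr rfl fun k _ => ?_
  change HahnSeries.single (-(numer r (k : ℚ) : ℤ)) ((P.erase 0).coeff k) = _
  rw [atInfinity_monomial, numer_natCast, Nat.cast_mul]

theorem eulerDeriv_single (r : ℕ) (k : ℤ) (a : ℂ) :
    eulerDeriv r (HahnSeries.single k a) = HahnSeries.single k (-(k / r) * a) := by
  rw [eulerDeriv, LaurentSeries.derivative_apply, LaurentSeries.hasseDeriv_single,
    HahnSeries.single_mul_single]
  ext m
  rw [HahnSeries.coeff_smul]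
  by_cases hm : m = k <;> simp [hm, div_eq_inv_mul, mul_assoc]

theorem eulerDeriv_add (r : ℕ) (f g : LaurentSeries ℂ) :
    eulerDeriv r (f + g) = eulerDeriv r f + eulerDeriv r g := by
  rw [eulerDeriv, map_add, mul_add, smul_add]
  rfl

theorem eulerDeriv_atInfinity {r : ℕ} (hr : r ≠ 0) (P : ℂ[X]) :
    eulerDeriv r (atInfinity r P) = atInfinity r (X * derivative P) := by
  have hadd (p q : ℂ[X]) : atInfinity r (p + q) = atInfinity r p + atInfinity r q := by
    rw [atInfinity_eq_aeval, map_add]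
  induction P using Polynomial.induction_on' with
  | add p q hp hq => rw [hadd, eulerDeriv_add, hp, hq, derivative_add, mul_add, hadd]
  | monomial k a =>
    rw [atInfinity_monomial, eulerDeriv_single, derivative_monomial, X_mul_monomial]
    rcases k with _ | k
    · simp [atInfinity_eq_aeval]
    · rw [Nat.add_sub_cancel, atInfinity_monomial]
      congr 1
      push_cast
      field_simp

theorem derivative_erase_zero {R : Type*} [Semiring R] (P : R[X]) :
    derivative (P.erase 0) = derivative P := by
  conv_rhs => rw [← monomial_add_erase P 0, derivative_add, monomial_zero_left, derivative_C,
    zero_add]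

theorem eulerDeriv_toLaurent_ofPolynomial {r : ℕ} (hr : r ≠ 0) (P : ℂ[X]) :
    eulerDeriv r ((ofPolynomial P).toLaurent r) = atInfinity r (X * derivative P) := by
  rw [toLaurent_ofPolynomial, eulerDeriv_atInfinity hr, derivative_erase_zero]

theorem map_eulerDeriv_one {n : Type*} [DecidableEq n] {r : ℕ} (hr : r ≠ 0) :
    (1 : Matrix n n (LaurentSeries ℂ)).map (eulerDeriv r) = 0 := by
  have hC (c : ℂ) : eulerDeriv r (atInfinity r (C c)) = 0 := by
    rw [eulerDeriv_atInfinity hr, derivative_C, mul_zero, atInfinity_eq_aeval, map_zero]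
  have hzero : eulerDeriv r 0 = 0 := by simpa only [atInfinity_eq_aeval, map_zero] using hC 0
  have hone : eulerDeriv r 1 = 0 := by simpa only [atInfinity_eq_aeval, map_one] using hC 1
  rw [← Matrix.diagonal_one, Matrix.diagonal_map hzero]
  simp [hone]

/-- The untwisted irregular class `∑ i, ⟨P i⟩` of a finite family of polynomials. -/
def IrregularClass.ofPolynomials {ι : Type*} [Fintype ι] (P : ι → ℂ[X]) : IrregularClass :=
  ∑ i, Finsupp.single (ofPolynomial (P i)).circle 1

namespace IrregularClass

variable {ι : Type*} [Fintype ι] (P : ι → ℂ[X])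

theorem ofPolynomials_circle (p : ExpFactor) :
    ofPolynomials P p.circle = Nat.card {i // ofPolynomial (P i) = p} := by
  classical
  simp [ofPolynomials, Finsupp.single_apply, Fintype.card_subtype,
    (hasDenominator_one_ofPolynomial _).circle_eq_iff]

theorem mem_support_ofPolynomials {I : StokesCircle} :
    I ∈ (ofPolynomials P).support ↔ I ∈ Set.range fun i => (ofPolynomial (P i)).circle := by
  classical
  simp [ofPolynomials, Finsupp.single_apply]

theorem isUntwisted_ofPolynomials : (ofPolynomials P).IsUntwisted := fun I hI => by
  obtain ⟨i, rfl⟩ := (mem_support_ofPolynomials P).1 hI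
  exact ram_ofPolynomial (P i)

end IrregularClass

theorem AffineLineConnection.hasIrregularClass_diagonal {n : ℕ} (P : Fin n → ℂ[X]) :
    (diagonal fun i => derivative (P i)).HasIrregularClass (.ofPolynomials P) := by
  refine ⟨1, n, Pi.basisFun ℂ[X] (Fin n), fun i => ofPolynomial (P i), 1, 0, le_rfl,
    fun i => hasDenominator_one_ofPolynomial (P i), fun _ _ _ => rfl, ?_,
    fun p => (IrregularClass.ofPolynomials_circle P p).symm⟩
  simp only [connMatrix_diagonal, Units.val_one, map_eulerDeriv_one one_ne_zero,
    eulerDeriv_toLaurent_ofPolynomial one_ne_zero, atInfinity_eq_aeval, Matrix.diagonal_map,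
    Matrix.map_zero, map_zero, mul_one, one_mul, add_zero, zero_sub]
  ext1 i j
  rcases eq_or_ne i j with rfl | hij
  · simp only [Matrix.smul_apply, Matrix.neg_apply, Matrix.diagonal_apply_eq, Pi.neg_apply,
      smul_eq_mul]
    rw [← map_mul, mul_neg, map_neg]
  · simp [hij]

/-! ### Fission graphs -/

namespace Diagram

variable {N : Type*} {Γ : Diagram N}

theorem mult_comm (Γ : Diagram N) (i j : N) : Γ.mult i j = Γ.mult j i :=
  Γ.symm.apply j i

open Classical in
/-- The degree which `q_i - q_j` must have in order that `Γ` is the core diagram of the circles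
`⟨q_i⟩`: it is `B_ij + 1` for `i ≠ j` and `0` for `i = j`. -/
def fissionDist (Γ : Diagram N) (i j : N) : ℕ := if i = j then 0 else (Γ.mult i j).toNat + 1

theorem fissionDist_eq_zero_iff {i j : N} : Γ.fissionDist i j = 0 ↔ i = j := by
  simp [fissionDist]

theorem IsGraph.mult_eq (hΓ : Γ.IsGraph) (i j : N) :
    Γ.mult i j = (Γ.fissionDist i j - 1 : ℕ) := by
  rcases eq_or_ne i j with rfl | hij
  · simp [fissionDist, hΓ.2]
  · simp [fissionDist, hij, hΓ.1]

theorem isGraph_and_eq_fissionDist {d : N → N → ℕ} (hd : ∀ i j, d i j = 0 ↔ i = j)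
    (h : ∀ i j, Γ.mult i j = (d i j - 1 : ℕ)) : Γ.IsGraph ∧ ∀ i j, d i j = Γ.fissionDist i j := by
  refine ⟨⟨fun i j => h i j ▸ Nat.cast_nonneg _, fun i => by simp [h, (hd i i).2 rfl]⟩,
    fun i j => ?_⟩
  rcases eq_or_ne i j with rfl | hij
  · simp [fissionDist, (hd i i).2 rfl]
  · have := (hd i j).not.2 hij
    rw [fissionDist, if_neg hij, h]
    omega

theorem IsGraph.isUltrametric_fissionDist_iff (hΓ : Γ.IsGraph) :
    IsUltrametric Γ.fissionDist ↔
      ∀ i j k : N, i ≠ j → j ≠ k → i ≠ k → Γ.IsAcuteIsosceles i j k := by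
  constructor
  · intro hd i j k hij hjk hik
    have h₁ := hd.le_max i j k
    have h₂ := hd.le_max j i k
    have h₃ := hd.le_max i k j
    rw [hd.symm j i] at h₂
    rw [hd.symm k j] at h₃
    rw [IsAcuteIsosceles]
    simp only [fissionDist, hij, hjk, hik, if_false] at h₁ h₂ h₃
    have := hΓ.1 i j
    have := hΓ.1 j k
    have := hΓ.1 i k
    omega
  · intro h
    refine ⟨fun i => fissionDist_eq_zero_iff.2 rfl, fun i j => ?_, fun i j k => ?_⟩
    · rcases eq_or_ne i j with rfl | hij
      · rfl
      · rw [fissionDist, fissionDist, if_neg hij, if_neg hij.symm, Γ.mult_comm]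
    · rcases eq_or_ne i j with rfl | hij
      · exact le_max_right _ _
      rcases eq_or_ne j k with rfl | hjk
      · exact le_max_left _ _
      rcases eq_or_ne i k with rfl | hik
      · exact (fissionDist_eq_zero_iff.2 rfl).trans_le (Nat.zero_le _)
      have hacute := h i j k hij hjk hik
      rw [IsAcuteIsosceles] at hacute
      simp only [fissionDist, hij, hjk, hik, if_false]
      omega

theorem IsFissionGraph.finite (h : Γ.IsFissionGraph) : Finite N := by
  obtain ⟨-, Θ, -, -, e, -⟩ := h
  exact Finite.of_equiv _ e.symm

theorem IsFissionGraph.isGraph_and_exists_natDegree_sub_eq (h : Γ.IsFissionGraph) :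
    Γ.IsGraph ∧ ∃ P : N → ℂ[X], ∀ i j, (P i - P j).natDegree = Γ.fissionDist i j := by
  obtain ⟨-, Θ, -, hΘ, e, he⟩ := h
  have hrep (i : N) : ∃ P : ℂ[X], (ofPolynomial P).circle = (e i).1 := by
    obtain ⟨q, hq⟩ := Quotient.exists_rep (e i).1
    have hram : q.ram = 1 := by
      have := hΘ _ (e i).2
      rwa [← hq] at this
    obtain ⟨P, rfl⟩ := hasDenominator_one_iff.1 (ram_eq_one_iff.1 hram)
    exact ⟨P, hq⟩
  choose P hP using hrep
  have hd (i j : N) : (P i - P j).natDegree = 0 ↔ i = j := by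
    rw [← ofPolynomial_eq_iff, ← (hasDenominator_one_ofPolynomial _).circle_eq_iff, hP, hP,
      Subtype.coe_inj, e.apply_eq_iff_eq]
  have hmult (i j : N) : Γ.mult i j = ((P i - P j).natDegree - 1 : ℕ) := by
    rw [he, ← hP, ← hP, mult_circle_ofPolynomial]
  exact (isGraph_and_eq_fissionDist hd hmult).imp_right fun hdist => ⟨P, hdist⟩

theorem IsGraph.isCoreDiagram_ofPolynomials [Fintype N] (hΓ : Γ.IsGraph) {P : N → ℂ[X]}
    (hP : ∀ i j, (P i - P j).natDegree = Γ.fissionDist i j) :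
    Γ.IsCoreDiagram (.ofPolynomials P) := by
  have hinj : Function.Injective fun i => (ofPolynomial (P i)).circle := fun i j hij => by
    rwa [(hasDenominator_one_ofPolynomial _).circle_eq_iff, ofPolynomial_eq_iff, hP,
      fissionDist_eq_zero_iff] at hij
  refine ⟨(Equiv.ofInjective _ hinj).trans
    (Equiv.subtypeEquivRight fun I => (IrregularClass.mem_support_ofPolynomials P).symm),
    fun i j => ?_⟩
  rw [hΓ.mult_eq, ← hP]
  exact (mult_circle_ofPolynomial (P i) (P j)).symm

theorem IsGraph.isFissionGraph_of_natDegree_sub_eq [Finite N] (hΓ : Γ.IsGraph) {P : N → ℂ[X]}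
    (hP : ∀ i j, (P i - P j).natDegree = Γ.fissionDist i j) : Γ.IsFissionGraph := by
  have := Fintype.ofFinite N
  let ε := Finite.equivFin N
  have hclass : IrregularClass.ofPolynomials (P ∘ ε.symm) = .ofPolynomials P :=
    ε.symm.sum_comp fun i => Finsupp.single (ofPolynomial (P i)).circle 1
  exact ⟨_, _, hclass ▸ AffineLineConnection.hasIrregularClass_diagonal (P ∘ ε.symm),
    IrregularClass.isUntwisted_ofPolynomials P, hΓ.isCoreDiagram_ofPolynomials hP⟩

end Diagram

end NAH

end

theorem theorem3p2_general {N : Type*} (Γ : NAH.Diagram N) :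
    Γ.IsFissionGraph ↔ Finite N ∧ Γ.IsGraph ∧
      ∀ i j k : N, i ≠ j → j ≠ k → i ≠ k → Γ.IsAcuteIsosceles i j k := by
  constructor
  · intro h
    obtain ⟨hΓ, P, hP⟩ := h.isGraph_and_exists_natDegree_sub_eq
    have hd : NAH.IsUltrametric Γ.fissionDist := by
      simpa only [hP] using NAH.isUltrametric_natDegree_sub P
    exact ⟨h.finite, hΓ, hΓ.isUltrametric_fissionDist_iff.1 hd⟩
  · rintro ⟨_, hΓ, htri⟩
    obtain ⟨P, hP⟩ := (hΓ.isUltrametric_fissionDist_iff.2 htri).exists_natDegree_sub_eq (R := ℂ)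
    exact hΓ.isFissionGraph_of_natDegree_sub_eq hP

theorem theorem3p2 {N : Type*} [Finite N] (Γ : NAH.Diagram N) (hΓ : Γ.IsGraph) :
    Γ.IsFissionGraph ↔
      ∀ i j k : N, i ≠ j → j ≠ k → i ≠ k → Γ.IsAcuteIsosceles i j k := by
  rw [theorem3p2_general, and_iff_right ‹Finite N›, and_iff_right hΓ]
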